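/- Let $k$ be a commutative noetherian ring. Let $\mathcal C$ be the category whose objects are the finite sets, whose morphisms from $X$ to $Y$ are the correspondences (the subsets of $Y\times X$), and whose composition is $RS=\{(z,x)\mid \exists\, y\in Y,\ (z,y)\in R \text{ and } (y,x)\in S\}$ for $R\subseteq Z\times Y$, $S\subseteq Y\times X$. A correspondence functor over $k$ is a functor from $\mathcal C$ to the category of $k$-modules (equivalently, a $k$-linear functor from the $k$-linearization $k\mathcal C$); let $\mathcal F_k$ be the abelian category of correspondence functors. For a finite set $F$, let $\mathcal R_F=k\mathcal C(F,F)$ be the $k$-algebra of the monoid of relations on $F$; if $M$ is a correspondence functor, $M(F)$ is a left $\mathcal R_F$-module, and evaluation at $F$ is an exact $k$-linear functor from $\mathcal F_k$ to the category of $\mathcal R_F$-modules. One says that $M$ is generated by $M(E)$ if $M(X)=k\mathcal C(X,E)\,M(E)$ for every finite set $X$, and that $M$ has bounded type if $M$ is generated by $M(E)$ for some finite set $E$. Let $M$ and $N$ be correspondence functors over $k$. (a) Let $E$ and $F$ be finite sets. If $M$ is generated by $M(E)$ and $|F|\ge 2^{|E|}$, then the evaluation map at $F$ $$\operatorname{Hom}_{\mathcal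 F_k}(M,N)\to \operatorname{Hom}_{\mathcal R_F}\big(M(F),N(F)\big)$$ is an isomorphism (of $k$-modules). (b) If $M$ has bounded type, then for every integer $i\ge 0$ there exists an integer $n_i$ such that, for every finite set $F$ with $|F|\ge n_i$, the evaluation map $$\operatorname{Ext}^i_{\mathcal F_k}(M,N)\to \operatorname{Ext}^i_{\mathcal R_F}\big(M(F),N(F)\big)$$ is an isomorphism (of $k$-modules). -/

import Mathlib

open CategoryTheory CategoryTheory.Limits

universe v u

/-- The objects of the category `𝒞`: finite sets. -/
structure FinCorr : Type (v + 1) where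
  /-- the underlying set -/
  carrier : Type v
  [finite : Finite carrier]

namespace FinCorr

attribute [instance] FinCorr.finite

/-- Composition of correspondences: for `R ⊆ Z × Y` and `S ⊆ Y × X`,
`RS = {(z, x) | ∃ y, (z, y) ∈ R ∧ (y, x) ∈ S} ⊆ Z × X`. -/
def comp {X Y Z : Type v} (R : Set (Z × Y)) (S : Set (Y × X)) : Set (Z × X) :=
  {p | ∃ y : Y, (p.1, y) ∈ R ∧ (y, p.2) ∈ S}

/-- The category `𝒞` of finite sets and correspondences: a morphism from `X` to `Y` is a subset
of `Y × X`, the identity of `X` is the diagonal. -/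
instance : Category.{v} FinCorr.{v} where
  Hom X Y := Set (Y.carrier × X.carrier)
  id X := {p | p.1 = p.2}
  comp S R := FinCorr.comp R S
  id_comp S := by
    ext ⟨y, x⟩
    simp [FinCorr.comp]
  comp_id S := by
    ext ⟨y, x⟩
    simp [FinCorr.comp]
  assoc S R Q := by
    ext ⟨w, x⟩
    constructor
    · rintro ⟨z, hz, y, hy, hx⟩
      exact ⟨y, ⟨z, hz, hy⟩, hx⟩
    · rintro ⟨y, ⟨z, hz, hy⟩, hx⟩
      exact ⟨z, hz, y, hy, hx⟩

/-- The cardinality of a finite set. -/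
noncomputable def card (X : FinCorr.{v}) : ℕ := Nat.card X.carrier

end FinCorr

noncomputable section

/-- The abelian category `ℱ_k` of correspondence functors over `k`. Functors from `𝒞` to
`k`-modules are the same as `k`-linear functors on the `k`-linearization of `𝒞`. -/
abbrev CorrFunctor (k : Type u) [CommRing k] : Type (max (u + 1) (v + 1)) :=
  FinCorr.{v} ⥤ ModuleCat.{max u v} k

/-- The algebra `R_E = k𝒞(E, E)` of the monoid of relations on `E`. The product of `End E` is
`R * S = S ≫ R`, that is, the product `RS` of relations. -/
abbrev RelAlgebra (k : Type u) [CommRing k] (E : FinCorr.{v}) : Type max u v :=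
  MonoidAlgebra k (End E)

namespace CorrFunctor

variable {k : Type u} [CommRing k]

/-- `M` is generated by `M(E)`: one has `M(X) = k𝒞(X, E) M(E)` for every finite set `X`. -/
def GeneratedBy (M : CorrFunctor.{v} k) (E : FinCorr.{v}) : Prop :=
  ∀ X : FinCorr.{v},
    Submodule.span k {x : M.obj X | ∃ (R : E ⟶ X) (m : M.obj E), (M.map R).hom m = x} = ⊤

/-- `M` has bounded type: it is generated by its evaluation at some finite set. -/
def BoundedType (M : CorrFunctor.{v} k) : Prop :=
  ∃ E : FinCorr.{v}, M.GeneratedBy E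

/-- The action of the monoid of relations on `E` on `M(E)`. -/
def relAction (M : CorrFunctor.{v} k) (E : FinCorr.{v}) :
    End E →* Module.End k (M.obj E) where
  toFun R := (M.map R).hom
  map_one' := by
    change (M.map (𝟙 E)).hom = _
    rw [M.map_id]
    rfl
  map_mul' R S := by
    change (M.map (S ≫ R)).hom = _
    rw [M.map_comp]
    rfl

/-- The action of `R_E` on `M(E)`, extending `R • m = M(R)(m)` linearly. -/
def algAction (M : CorrFunctor.{v} k) (E : FinCorr.{v}) :
    RelAlgebra k E →ₐ[k] Module.End k (M.obj E) :=
  MonoidAlgebra.lift k (Module.End k (M.obj E)) (End E) (M.relAction E)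

/-- The `R_E`-module `M(E)`. -/
def evalObj (M : CorrFunctor.{v} k) (E : FinCorr.{v}) :
    ModuleCat.{max u v} (RelAlgebra k E) :=
  letI : Module (RelAlgebra k E) (M.obj E) := Module.compHom _ (M.algAction E).toRingHom
  ModuleCat.of (RelAlgebra k E) (M.obj E)

lemma algAction_naturality {M N : CorrFunctor.{v} k} (φ : M ⟶ N) (E : FinCorr.{v})
    (a : RelAlgebra k E) (m : M.obj E) :
    (φ.app E).hom (M.algAction E a m) = N.algAction E a ((φ.app E).hom m) := by
  induction a using MonoidAlgebra.induction_on with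
  | of R =>
    simp only [algAction, MonoidAlgebra.lift_of]
    exact LinearMap.congr_fun (congrArg ModuleCat.Hom.hom (φ.naturality R)) m
  | add a b ha hb => simp only [map_add, LinearMap.add_apply, ha, hb]
  | smul r a ha => simp only [map_smul, LinearMap.smul_apply, ha]

variable (k) in
/-- Evaluation at `E`, as a functor from correspondence functors to `R_E`-modules. -/
def evaluation (E : FinCorr.{v}) :
    CorrFunctor.{v} k ⥤ ModuleCat.{max u v} (RelAlgebra k E) where
  obj M := M.evalObj E
  map {M N} φ := ModuleCat.ofHom (X := M.evalObj E) (Y := N.evalObj E)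
    { toFun := fun m => (φ.app E).hom m
      map_add' := fun x y => (φ.app E).hom.map_add x y
      map_smul' := fun a m => algAction_naturality φ E a m }

/-- The `k`-linear structure on the category of `R_E`-modules. -/
instance (E : FinCorr.{v}) : Linear k (ModuleCat.{max u v} (RelAlgebra k E)) :=
  ModuleCat.Algebra.instLinear

instance (E : FinCorr.{v}) : (evaluation k E).Additive where
  map_add := rfl

lemma algebraMap_smul_evalObj (M : CorrFunctor.{v} k) (E : FinCorr.{v}) (r : k) (m : M.obj E) :
    M.algAction E (algebraMap k (RelAlgebra k E) r) m = r • m := by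
  rw [AlgHom.commutes, Module.algebraMap_end_apply]

instance (E : FinCorr.{v}) : (evaluation k E).Linear k where
  map_smul {M N} φ r := by
    ext m
    exact (algebraMap_smul_evalObj N E r ((φ.app E).hom m)).symm

/-- Evaluating at `E` and then forgetting the action of `R_E` gives the abelian group `M(E)`. -/
def evaluationCompForget (E : FinCorr.{v}) :
    evaluation k E ⋙ forget₂ (ModuleCat.{max u v} (RelAlgebra k E)) AddCommGrpCat.{max u v} ≅
      (CategoryTheory.evaluation FinCorr.{v} (ModuleCat.{max u v} k)).obj E ⋙
        forget₂ (ModuleCat.{max u v} k) AddCommGrpCat.{max u v} :=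
  Iso.refl _

instance (E : FinCorr.{v}) : PreservesFiniteLimits (evaluation k E) := by
  let G := forget₂ (ModuleCat.{max u v} (RelAlgebra k E)) AddCommGrpCat.{max u v}
  have : PreservesFiniteLimits (evaluation k E ⋙ G) :=
    preservesFiniteLimits_of_natIso (evaluationCompForget E).symm
  have : ReflectsFiniteLimits G := inferInstance
  exact preservesFiniteLimits_of_reflects_of_preserves _ G

instance (E : FinCorr.{v}) : PreservesFiniteColimits (evaluation k E) := by
  let G := forget₂ (ModuleCat.{max u v} (RelAlgebra k E)) AddCommGrpCat.{max u v}
  have : PreservesFiniteColimits (evaluation k E ⋙ G) :=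
    preservesFiniteColimits_of_natIso (evaluationCompForget E).symm
  have : ReflectsFiniteColimits G := inferInstance
  exact preservesFiniteColimits_of_reflects_of_preserves _ G

/-- `Ext` groups of correspondence functors exist in a large enough universe. For modules over
`R_E` the corresponding fact is an instance in Mathlib. -/
instance : HasExt.{max (u + 1) (v + 1)} (CorrFunctor.{v} k) := HasExt.standard _

end CorrFunctor

end

/-! ### Retractions and factorizations of correspondences. -/

namespace FinCorr

/-! Let `2 ^ |E| ≤ |F|`. For `R : E ⟶ X`, having equal rows in `R` is an equivalence relation on `X`
with at most `2 ^ |E|` classes, so it factors through `F`. Composing with it fixes `R` and sends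
every relation from `E` to one containing it. Removing minimal relations one at a time therefore
writes any `y` in the part of `N(X)` generated by `N(E)` as a combination of elements `T S y` with
`S : X ⟶ F` and `T : F ⟶ X` (`mem_span_factorization`).

Such a `y` is thus zero once all its images in `N(F)` vanish, so that an `R_F`-linear `φ : M(F) →
N(F)` extends unambiguously by `∑ R m ↦ ∑ R φ(m)`: this is (a). Moreover, a subfunctor of a functor
generated at `E` is generated at `F` (`GeneratedBy.of_mono`), so the kernel of a free cover of `M`
again has bounded type. Since free functors evaluate to projective modules at large `F`, dimension
shifting reduces (b) to degree 0, which is (a). -/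

lemma mem_comp {X Y Z : FinCorr.{v}} (S : X ⟶ Y) (R : Y ⟶ Z) (z : Z.carrier) (x : X.carrier) :
    (z, x) ∈ (show Set (Z.carrier × X.carrier) from S ≫ R) ↔
      ∃ y : Y.carrier, (z, y) ∈ (show Set (Z.carrier × Y.carrier) from R) ∧
        (y, x) ∈ (show Set (Y.carrier × X.carrier) from S) :=
  Iff.rfl

lemma mem_id {X : FinCorr.{v}} (y x : X.carrier) :
    (y, x) ∈ (show Set (X.carrier × X.carrier) from 𝟙 X) ↔ y = x :=
  Iff.rfl

lemma exists_retract {E F : FinCorr.{v}} (h : E.card ≤ F.card) :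
    ∃ (s : E ⟶ F) (r : F ⟶ E), s ≫ r = 𝟙 E := by
  have := Fintype.ofFinite E.carrier
  have := Fintype.ofFinite F.carrier
  obtain ⟨ι⟩ : Nonempty (E.carrier ↪ F.carrier) := by
    apply Function.Embedding.nonempty_of_card_le
    simpa [card, Nat.card_eq_fintype_card] using h
  -- The graph of the injection, and its converse.
  refine ⟨{p | p.1 = ι p.2}, {p | p.2 = ι p.1}, Set.ext ?_⟩
  rintro ⟨y, x⟩
  refine (mem_comp _ _ y x).trans (Iff.trans ?_ (mem_id y x).symm)
  constructor
  · rintro ⟨f, hf, hf'⟩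
    exact ι.injective (hf.symm.trans hf')
  · rintro rfl
    exact ⟨ι y, rfl, rfl⟩

/-- The equivalence relation "equal rows of `R`" has at most `2 ^ |E|` classes, hence factors
through every set `F` with at least `2 ^ |E|` elements. -/
lemma exists_factorization {E F : FinCorr.{v}} (h : 2 ^ E.card ≤ F.card) {X : FinCorr.{v}}
    (R : Set (X.carrier × E.carrier)) :
    ∃ (S : X ⟶ F) (T : F ⟶ X), (show E ⟶ X from R) ≫ S ≫ T = R ∧
      ∀ R' : Set (X.carrier × E.carrier), R' ⊆ ((show E ⟶ X from R') ≫ S ≫ T) := by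
  classical
  have := Fintype.ofFinite E.carrier
  have := Fintype.ofFinite F.carrier
  obtain ⟨ι⟩ : Nonempty (Set E.carrier ↪ F.carrier) := by
    apply Function.Embedding.nonempty_of_card_le
    simpa [card, Nat.card_eq_fintype_card] using h
  let row : X.carrier → Set E.carrier := fun x => {e | (x, e) ∈ R}
  -- The graph of `x ↦ ι (row x)` and its converse; their composite on `X` relates points with equal
  -- rows.
  refine ⟨{p | p.1 = ι (row p.2)}, {p | p.2 = ι (row p.1)}, Set.ext ?_, ?_⟩
  · rintro ⟨x, e⟩
    constructor
    · rintro ⟨y, ⟨f, hf, hf'⟩, hy⟩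
      have hxy : row x = row y := ι.injective (hf.symm.trans hf')
      change e ∈ row x
      rw [hxy]
      exact hy
    · intro hx
      exact ⟨x, ⟨ι (row x), rfl, rfl⟩, hx⟩
  · rintro R' ⟨x, e⟩ hx
    exact ⟨x, ⟨ι (row x), rfl, rfl⟩, hx⟩

end FinCorr

namespace CorrFunctor

section

variable {k : Type u} [CommRing k]

/-! ### Recovering elements from their images at a large set. -/

/-- The value at `X` of the subfunctor of `M` generated by `M(E)`. -/
def generatedSubmodule (M : CorrFunctor.{v} k) (E X : FinCorr.{v}) : Submodule k (M.obj X) :=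
  Submodule.span k {x | ∃ (R : E ⟶ X) (m : M.obj E), (M.map R).hom m = x}

lemma map_comp_apply (M : CorrFunctor.{v} k) {X Y Z : FinCorr.{v}} (S : X ⟶ Y) (R : Y ⟶ Z)
    (x : M.obj X) : (M.map (S ≫ R)).hom x = (M.map R).hom ((M.map S).hom x) := by
  rw [M.map_comp]
  rfl

lemma map_id_apply (M : CorrFunctor.{v} k) {X : FinCorr.{v}} (x : M.obj X) :
    (M.map (𝟙 X)).hom x = x := by
  rw [M.map_id]
  rfl

lemma naturality_apply {M N : CorrFunctor.{v} k} (φ : M ⟶ N) {X Y : FinCorr.{v}} (R : X ⟶ Y)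
    (x : M.obj X) : (φ.app Y).hom ((M.map R).hom x) = (N.map R).hom ((φ.app X).hom x) :=
  LinearMap.congr_fun (congrArg ModuleCat.Hom.hom (φ.naturality R)) x

lemma map_mem_generatedSubmodule (M : CorrFunctor.{v} k) {E X Y : FinCorr.{v}} (Q : X ⟶ Y)
    {x : M.obj X} (hx : x ∈ M.generatedSubmodule E X) :
    (M.map Q).hom x ∈ M.generatedSubmodule E Y := by
  induction hx using Submodule.span_induction with
  | mem x hx =>
    obtain ⟨R, m, rfl⟩ := hx
    exact Submodule.subset_span ⟨R ≫ Q, m, M.map_comp_apply R Q m⟩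
  | zero => simp
  | add x y _ _ hx hy => simpa using add_mem hx hy
  | smul a x _ hx => simpa using Submodule.smul_mem _ a hx

/-- An element is recovered from its images in `M(F)`, as long as it is generated by relations
in an upper set of relations out of a set `E` with `2 ^ |E| ≤ |F|`. -/
lemma mem_span_factorization_of_isUpperSet (M : CorrFunctor.{v} k) {E F : FinCorr.{v}}
    (h : 2 ^ E.card ≤ F.card) {X : FinCorr.{v}} (U : Set (Set (X.carrier × E.carrier)))
    (hU : IsUpperSet U) (y : M.obj X)
    (hy : y ∈ Submodule.span k
      {x : M.obj X | ∃ (R : E ⟶ X) (m : M.obj E), R ∈ U ∧ (M.map R).hom m = x}) :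
    y ∈ Submodule.span k
      {x : M.obj X | ∃ (S : X ⟶ F) (T : F ⟶ X), (M.map T).hom ((M.map S).hom y) = x} := by
  induction U using WellFoundedLT.induction generalizing y with
  | ind U ih =>
  rcases U.eq_empty_or_nonempty with rfl | hne
  · have : y = 0 := by simpa using hy
    subst this
    exact zero_mem _
  obtain ⟨R, hR⟩ := U.toFinite.exists_minimal hne
  obtain ⟨S₀, T₀, hRR, hle⟩ := FinCorr.exists_factorization h R
  have hlt : U \ {R} < U := Set.sdiff_singleton_ssubset.2 hR.1
  have hup : IsUpperSet (U \ {R}) := by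
    rintro A B hAB ⟨hA, hAR⟩
    refine ⟨hU hAB hA, ?_⟩
    rintro rfl
    exact hAR (le_antisymm hAB (hR.2 hA hAB))
  -- `1 - T₀ S₀` kills the terms in `R` and replaces any other `R'` by `R'` minus a larger relation,
  -- so no `R` reappears.
  have hy' : y - (M.map T₀).hom ((M.map S₀).hom y) ∈ Submodule.span k
      {x : M.obj X | ∃ (R' : E ⟶ X) (m : M.obj E), R' ∈ U \ {R} ∧ (M.map R').hom m = x} := by
    induction hy using Submodule.span_induction with
    | mem x hx =>
      obtain ⟨R', m, hR', rfl⟩ := hx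
      rw [← M.map_comp_apply R' S₀, ← M.map_comp_apply, Category.assoc]
      by_cases hRR' : R' = R
      · subst hRR'
        rw [show R' ≫ S₀ ≫ T₀ = R' from hRR, sub_self]
        exact zero_mem _
      · refine sub_mem (Submodule.subset_span ⟨R', m, ⟨hR', hRR'⟩, rfl⟩)
          (Submodule.subset_span ⟨R' ≫ S₀ ≫ T₀, m, ?_, rfl⟩)
        exact hup (hle R') ⟨hR', hRR'⟩
    | zero => simp
    | add x y _ _ hx hy =>
      have := add_mem hx hy
      simp only [map_add]
      rwa [add_sub_add_comm]
    | smul a x _ hx =>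
      have := Submodule.smul_mem _ a hx
      simp only [map_smul]
      rwa [← smul_sub]
  have key := ih _ hlt hup _ hy'
  have hsub : Submodule.span k {x : M.obj X | ∃ (S : X ⟶ F) (T : F ⟶ X),
      (M.map T).hom ((M.map S).hom (y - (M.map T₀).hom ((M.map S₀).hom y))) = x} ≤
      Submodule.span k
        {x : M.obj X | ∃ (S : X ⟶ F) (T : F ⟶ X), (M.map T).hom ((M.map S).hom y) = x} := by
    rw [Submodule.span_le]
    rintro _ ⟨S, T, rfl⟩
    rw [map_sub, map_sub]
    refine sub_mem (Submodule.subset_span ⟨S, T, rfl⟩)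
      (Submodule.subset_span ⟨S₀ ≫ T₀ ≫ S, T, ?_⟩)
    simp only [map_comp_apply]
  have := add_mem (hsub key) (Submodule.subset_span ⟨S₀, T₀, rfl⟩)
  rwa [sub_add_cancel] at this

lemma mem_span_factorization (M : CorrFunctor.{v} k) {E F : FinCorr.{v}}
    (h : 2 ^ E.card ≤ F.card) {X : FinCorr.{v}} {y : M.obj X}
    (hy : y ∈ M.generatedSubmodule E X) :
    y ∈ Submodule.span k
      {x : M.obj X | ∃ (S : X ⟶ F) (T : F ⟶ X), (M.map T).hom ((M.map S).hom y) = x} := by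
  refine M.mem_span_factorization_of_isUpperSet h Set.univ isUpperSet_univ y ?_
  simpa [generatedSubmodule] using hy

lemma eq_zero_of_forall_map_eq_zero (M : CorrFunctor.{v} k) {E F : FinCorr.{v}}
    (h : 2 ^ E.card ≤ F.card) {X : FinCorr.{v}} {y : M.obj X}
    (hy : y ∈ M.generatedSubmodule E X) (hS : ∀ S : X ⟶ F, (M.map S).hom y = 0) : y = 0 := by
  have hle : Submodule.span k
      {x : M.obj X | ∃ (S : X ⟶ F) (T : F ⟶ X), (M.map T).hom ((M.map S).hom y) = x} ≤ ⊥ := by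
    rw [Submodule.span_le]
    rintro _ ⟨S, T, rfl⟩
    simp [hS]
  exact hle (M.mem_span_factorization h hy)

/-- If `K` is a subfunctor of a functor generated by its value at `E`, then `K` is generated by
its value at every set with at least `2 ^ |E|` elements. -/
lemma GeneratedBy.of_mono {K P : CorrFunctor.{v} k} (ι : K ⟶ P) [Mono ι] {E F : FinCorr.{v}}
    (hP : P.GeneratedBy E) (h : 2 ^ E.card ≤ F.card) : K.GeneratedBy F := by
  intro X
  rw [eq_top_iff]
  rintro x -
  have hinj : Function.Injective (ι.app X).hom := (ModuleCat.mono_iff_injective _).1 inferInstance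
  have hx : (ι.app X).hom x ∈ P.generatedSubmodule E X := by
    rw [generatedSubmodule, hP X]
    trivial
  have key := P.mem_span_factorization h hx
  have hle : Submodule.span k {z : P.obj X | ∃ (S : X ⟶ F) (T : F ⟶ X),
      (P.map T).hom ((P.map S).hom ((ι.app X).hom x)) = z} ≤
      (Submodule.span k {z : K.obj X | ∃ (R : F ⟶ X) (m : K.obj F), (K.map R).hom m = z}).map
        (ι.app X).hom := by
    rw [Submodule.span_le]
    rintro _ ⟨S, T, rfl⟩
    -- `T S ι(x) = ι(T (S x))`, and `S x` already lies in `K(F)`.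
    refine ⟨(K.map T).hom ((K.map S).hom x), Submodule.subset_span ⟨T, _, rfl⟩, ?_⟩
    rw [naturality_apply, naturality_apply]
  obtain ⟨x', hx', he⟩ := hle key
  rwa [← hinj he]

lemma GeneratedBy.of_retract {M : CorrFunctor.{v} k} {E F : FinCorr.{v}} (hM : M.GeneratedBy E)
    (h : E.card ≤ F.card) : M.GeneratedBy F := by
  obtain ⟨s, r, hsr⟩ := FinCorr.exists_retract h
  intro X
  rw [eq_top_iff, ← hM X, Submodule.span_le]
  rintro _ ⟨R, m, rfl⟩
  refine Submodule.subset_span ⟨r ≫ R, (M.map s).hom m, ?_⟩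
  rw [← map_comp_apply, ← Category.assoc, hsr, Category.id_comp]

/-! ### Evaluation on morphisms. -/

/-- The action of a relation `R` on `M(F)`, as a scalar multiplication. -/
lemma of_smul_evalObj (M : CorrFunctor.{v} k) (F : FinCorr.{v}) (R : F ⟶ F) (m : M.obj F) :
    (MonoidAlgebra.of k (End F) R • (show M.evalObj F from m) : M.evalObj F) =
      (M.map R).hom m := by
  change M.algAction F (MonoidAlgebra.of k (End F) R) m = _
  rw [algAction, MonoidAlgebra.lift_of]
  rfl

lemma algebraMap_smul_evalObj' (M : CorrFunctor.{v} k) (F : FinCorr.{v}) (a : k) (m : M.obj F) :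
    (algebraMap k (RelAlgebra k F) a • (show M.evalObj F from m) : M.evalObj F) = a • m :=
  algebraMap_smul_evalObj M F a m

/-- A homomorphism of `R_F`-modules `M(F) → N(F)`, seen as a `k`-linear map. -/
noncomputable def evalHom {M N : CorrFunctor.{v} k} {F : FinCorr.{v}}
    (φ : (evaluation k F).obj M ⟶ (evaluation k F).obj N) : M.obj F →ₗ[k] N.obj F where
  toFun m := φ.hom (show M.evalObj F from m)
  map_add' x y := φ.hom.map_add _ _
  map_smul' a x := by
    have := φ.hom.map_smul (algebraMap k (RelAlgebra k F) a) (show M.evalObj F from x)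
    exact (congrArg φ.hom (algebraMap_smul_evalObj' M F a x).symm).trans
      (this.trans (algebraMap_smul_evalObj' N F a _))

lemma evalHom_map {M N : CorrFunctor.{v} k} {F : FinCorr.{v}}
    (φ : (evaluation k F).obj M ⟶ (evaluation k F).obj N) (R : F ⟶ F) (m : M.obj F) :
    evalHom φ ((M.map R).hom m) = (N.map R).hom (evalHom φ m) := by
  have := φ.hom.map_smul (MonoidAlgebra.of k (End F) R) (show M.evalObj F from m)
  exact (congrArg φ.hom (of_smul_evalObj M F R m).symm).trans
    (this.trans (of_smul_evalObj N F R _))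

lemma evaluation_map_injective {M N : CorrFunctor.{v} k} {F : FinCorr.{v}}
    (hM : M.GeneratedBy F) :
    Function.Injective ((evaluation k F).map : (M ⟶ N) → _) := by
  intro φ ψ hφψ
  ext X : 2
  apply ModuleCat.hom_ext
  apply LinearMap.ext_on (hM X)
  rintro _ ⟨R, m, rfl⟩
  rw [naturality_apply, naturality_apply]
  congr 1
  exact LinearMap.congr_fun (congrArg ModuleCat.Hom.hom hφψ) m

/-- Although `φ` only commutes with endomorphisms of `F`, a retraction `r` of `s : E ⟶ F` gives `φ(R
m) = φ((R r)(s m)) = R (r φ(s m))`, with `r φ(s m)` in `N(E)`. -/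
lemma evalHom_mem_generatedSubmodule {M N : CorrFunctor.{v} k} {E F : FinCorr.{v}}
    (hM : M.GeneratedBy E) (h : E.card ≤ F.card)
    (φ : (evaluation k F).obj M ⟶ (evaluation k F).obj N) (m : M.obj F) :
    evalHom φ m ∈ N.generatedSubmodule E F := by
  obtain ⟨s, r, hsr⟩ := FinCorr.exists_retract h
  have hm : m ∈ M.generatedSubmodule E F := by
    rw [generatedSubmodule, hM F]
    trivial
  induction hm using Submodule.span_induction with
  | mem x hx =>
    obtain ⟨R, m, rfl⟩ := hx
    refine Submodule.subset_span ⟨R, (N.map r).hom (evalHom φ ((M.map s).hom m)), ?_⟩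
    rw [← map_comp_apply, ← evalHom_map, ← map_comp_apply, ← Category.assoc, hsr,
      Category.id_comp]
  | zero => simp
  | add x y _ _ hx hy => simpa using add_mem hx hy
  | smul a x _ hx => simpa using Submodule.smul_mem _ a hx

/-- Characterizing `∑ R φ(m)` by its images in `N(F)` makes it independent of the expression `x = ∑
R m`. Membership in the part generated by `N(E)` is what gives uniqueness, as `N` is arbitrary. -/
lemma exists_unique_extension {M N : CorrFunctor.{v} k} {E F : FinCorr.{v}}
    (hM : M.GeneratedBy E) (h : 2 ^ E.card ≤ F.card)
    (φ : (evaluation k F).obj M ⟶ (evaluation k F).obj N) (X : FinCorr.{v}) (x : M.obj X) :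
    ∃! y : N.obj X, y ∈ N.generatedSubmodule E X ∧
      ∀ S : X ⟶ F, (N.map S).hom y = evalHom φ ((M.map S).hom x) := by
  have hEF : E.card ≤ F.card := Nat.lt_two_pow_self.le.trans h
  refine existsUnique_of_exists_of_unique ?_ ?_
  · have hx : x ∈ M.generatedSubmodule F X := by
      rw [generatedSubmodule, hM.of_retract hEF X]
      trivial
    induction hx using Submodule.span_induction with
    | mem x hx =>
      obtain ⟨R, m, rfl⟩ := hx
      refine ⟨(N.map R).hom (evalHom φ m),
        N.map_mem_generatedSubmodule R (evalHom_mem_generatedSubmodule hM hEF φ m), fun S => ?_⟩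
      rw [← map_comp_apply, ← map_comp_apply, evalHom_map]
    | zero => exact ⟨0, zero_mem _, fun S => by simp⟩
    | add x y _ _ hx hy =>
      obtain ⟨x', hx', hx''⟩ := hx
      obtain ⟨y', hy', hy''⟩ := hy
      exact ⟨x' + y', add_mem hx' hy', fun S => by simp only [map_add, hx'', hy'']⟩
    | smul a x _ hx =>
      obtain ⟨x', hx', hx''⟩ := hx
      exact ⟨a • x', Submodule.smul_mem _ a hx', fun S => by simp only [map_smul, hx'']⟩
  · rintro y y' ⟨hy, hS⟩ ⟨hy', hS'⟩
    rw [← sub_eq_zero]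
    refine N.eq_zero_of_forall_map_eq_zero h (sub_mem hy hy') fun S => ?_
    rw [map_sub, hS, hS', sub_self]

lemma evaluation_map_surjective {M N : CorrFunctor.{v} k} {E F : FinCorr.{v}}
    (hM : M.GeneratedBy E) (h : 2 ^ E.card ≤ F.card) :
    Function.Surjective ((evaluation k F).map : (M ⟶ N) → _) := by
  intro φ
  choose ψ hψ huniq using exists_unique_extension hM h φ
  -- Linearity and naturality both follow from uniqueness.
  let Ψ : M ⟶ N :=
    { app X := ModuleCat.ofHom
        { toFun := ψ X
          map_add' x y := (huniq X _ _ ⟨add_mem (hψ X x).1 (hψ X y).1, fun S => by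
            simp only [map_add, (hψ X _).2]⟩).symm
          map_smul' a x := (huniq X _ _ ⟨Submodule.smul_mem _ a (hψ X x).1, fun S => by
            simp only [map_smul, (hψ X _).2]⟩).symm }
      naturality X Y Q := by
        ext x
        refine (huniq Y _ _ ⟨N.map_mem_generatedSubmodule Q (hψ X x).1, fun S => ?_⟩).symm
        rw [← map_comp_apply, (hψ X x).2, map_comp_apply]
        rfl }
  refine ⟨Ψ, ?_⟩
  ext m
  have := (hψ F m).2 (𝟙 F)
  exact (N.map_id_apply _).symm.trans (this.trans (congrArg (evalHom φ) (M.map_id_apply m)))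

lemma evaluation_map_bijective {M N : CorrFunctor.{v} k} {E F : FinCorr.{v}}
    (hM : M.GeneratedBy E) (h : 2 ^ E.card ≤ F.card) :
    Function.Bijective ((evaluation k F).map : (M ⟶ N) → _) :=
  ⟨evaluation_map_injective (hM.of_retract (Nat.lt_two_pow_self.le.trans h)),
    evaluation_map_surjective hM h⟩

/-! ### Free functors and their evaluations. -/

variable (k) in
/-- The direct sum of copies of the representable functor `k𝒞(-, E)` indexed by `I`. -/
noncomputable def free (E : FinCorr.{v}) (I : Type max u v) : CorrFunctor.{v} k where
  obj X := ModuleCat.of k (((E ⟶ X) × I) →₀ k)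
  map Q := ModuleCat.ofHom (Finsupp.lmapDomain k k fun p => (p.1 ≫ Q, p.2))
  map_id X := by
    apply ModuleCat.hom_ext
    refine Finsupp.lhom_ext' fun p => LinearMap.ext_ring ?_
    simp
  map_comp Q Q' := by
    apply ModuleCat.hom_ext
    refine Finsupp.lhom_ext' fun p => LinearMap.ext_ring ?_
    simp [Finsupp.mapDomain_single]

/-- The basis element of `free k E I` at `X` given by `R : E ⟶ X` and `i : I`. -/
noncomputable def freeSingle (E : FinCorr.{v}) (I : Type max u v) {X : FinCorr.{v}} (R : E ⟶ X) (i : I) :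
    (free k E I).obj X :=
  (Finsupp.single (R, i) 1 : ((E ⟶ X) × I) →₀ k)

lemma free_map_single (E : FinCorr.{v}) (I : Type max u v) {X Y : FinCorr.{v}} (R : E ⟶ X)
    (Q : X ⟶ Y) (i : I) :
    ((free k E I).map Q).hom (freeSingle E I R i) = freeSingle E I (R ≫ Q) i :=
  Finsupp.mapDomain_single

lemma free_hom_ext {E : FinCorr.{v}} {I : Type max u v} {X : FinCorr.{v}} {V : Type*}
    [AddCommGroup V] [Module k V] {f g : (free k E I).obj X →ₗ[k] V}
    (h : ∀ R i, f (freeSingle E I R i) = g (freeSingle E I R i)) : f = g :=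
  Finsupp.lhom_ext' fun p => LinearMap.ext_ring (h p.1 p.2)

lemma span_freeSingle (E : FinCorr.{v}) (I : Type max u v) (X : FinCorr.{v}) :
    Submodule.span k {x : (free k E I).obj X | ∃ R i, freeSingle E I R i = x} = ⊤ := by
  rw [eq_top_iff]
  rintro x -
  change ((E ⟶ X) × I) →₀ k at x
  induction x using Finsupp.induction_linear with
  | zero => exact zero_mem _
  | add x y hx hy => exact add_mem hx hy
  | single p a =>
    have : (Finsupp.single p a : ((E ⟶ X) × I) →₀ k) = a • Finsupp.single (p.1, p.2) 1 := by
      simp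
    rw [this]
    exact Submodule.smul_mem _ a (Submodule.subset_span ⟨p.1, p.2, rfl⟩)

lemma free_generatedBy (E : FinCorr.{v}) (I : Type max u v) : (free k E I).GeneratedBy E := by
  intro X
  rw [eq_top_iff, ← span_freeSingle E I X, Submodule.span_le]
  rintro _ ⟨R, i, rfl⟩
  refine Submodule.subset_span ⟨R, freeSingle E I (𝟙 E) i, ?_⟩
  rw [free_map_single, Category.id_comp]

/-- The morphism out of a free functor with prescribed values on the generators. -/
noncomputable def freeDesc {E : FinCorr.{v}} {I : Type max u v} (N : CorrFunctor.{v} k) (n : I → N.obj E) :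
    free k E I ⟶ N where
  app X := ModuleCat.ofHom (X := ((E ⟶ X) × I) →₀ k)
    (Finsupp.linearCombination k fun p : (E ⟶ X) × I => (N.map p.1).hom (n p.2))
  naturality X Y Q := by
    apply ModuleCat.hom_ext
    refine Finsupp.lhom_ext' fun p => LinearMap.ext_ring ?_
    simp [free, Finsupp.mapDomain_single]

lemma freeDesc_single {E : FinCorr.{v}} {I : Type max u v} (N : CorrFunctor.{v} k)
    (n : I → N.obj E) {X : FinCorr.{v}} (R : E ⟶ X) (i : I) :
    ((freeDesc N n).app X).hom (freeSingle E I R i) = (N.map R).hom (n i) :=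
  (Finsupp.linearCombination_single k _ _).trans (one_smul k _)

/-- By Yoneda, a morphism out of a free functor is a family of elements at `E`, and these lift along
the surjection `e.app E`. -/
instance free_projective (E : FinCorr.{v}) (I : Type max u v) : Projective (free k E I) where
  factors {A B} f e he := by
    have hsurj : Function.Surjective (e.app E).hom :=
      (ModuleCat.epi_iff_surjective _).1 inferInstance
    choose a ha using fun i => hsurj ((f.app E).hom (freeSingle E I (𝟙 E) i))
    refine ⟨freeDesc A a, ?_⟩
    ext X : 2
    apply ModuleCat.hom_ext
    refine free_hom_ext fun R i => ?_
    change (e.app X).hom (((freeDesc A a).app X).hom _) = _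
    rw [freeDesc_single, naturality_apply, ha, ← naturality_apply, free_map_single,
      Category.id_comp]

lemma freeDesc_epi {M : CorrFunctor.{v} k} {E : FinCorr.{v}} (hM : M.GeneratedBy E) :
    Epi (freeDesc M (id : M.obj E → M.obj E)) := by
  rw [NatTrans.epi_iff_epi_app]
  intro X
  rw [ModuleCat.epi_iff_surjective]
  change Function.Surjective ((freeDesc M id).app X).hom
  rw [← LinearMap.range_eq_top, eq_top_iff, ← hM X, Submodule.span_le]
  rintro _ ⟨R, m, rfl⟩
  exact ⟨freeSingle E _ R m, freeDesc_single M id R m⟩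

/-- Since `E` is a retract of `F`, precomposition with `r` and `s` makes this module a direct
summand of a free `R_F`-module on `I`. -/
lemma projective_evaluation_free {E F : FinCorr.{v}} (I : Type max u v) (h : E.card ≤ F.card) :
    Projective ((evaluation k F).obj (free k E I)) := by
  obtain ⟨s, r, hsr⟩ := FinCorr.exists_retract h
  let f₀ : (free k E I).obj F →ₗ[k] (I →₀ RelAlgebra k F) :=
    Finsupp.linearCombination k fun p : (E ⟶ F) × I =>
      Finsupp.single p.2 (MonoidAlgebra.of k (End F) (r ≫ p.1))
  have hf₀ (R : E ⟶ F) (i : I) : f₀ (freeSingle E I R i) =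
      Finsupp.single i (MonoidAlgebra.of k (End F) (r ≫ R)) :=
    (Finsupp.linearCombination_single k _ _).trans (one_smul k _)
  have hlin (a : RelAlgebra k F) (x : (free k E I).obj F) :
      f₀ ((free k E I).algAction F a x) = a • f₀ x := by
    induction a using MonoidAlgebra.induction_on with
    | of Q =>
      have hx : x ∈ Submodule.span k {x : (free k E I).obj F | ∃ R i, freeSingle E I R i = x} := by
        rw [span_freeSingle]
        trivial
      rw [show (free k E I).algAction F (MonoidAlgebra.of k (End F) Q) x =
        ((free k E I).map Q).hom x from of_smul_evalObj _ F Q x]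
      induction hx using Submodule.span_induction with
      | mem x hx =>
        obtain ⟨R, i, rfl⟩ := hx
        rw [free_map_single, hf₀, hf₀, Finsupp.smul_single, smul_eq_mul, ← map_mul]
        rw [← Category.assoc]
        rfl
      | zero => simp
      | add x y _ _ hx hy => simp only [map_add, hx, hy, smul_add]
      | smul c x _ hx => simp only [map_smul, hx, smul_comm c]
    | add a b ha hb => simp only [map_add, LinearMap.add_apply, ha, hb, add_smul]
    | smul c a ha => simp only [map_smul, LinearMap.smul_apply, ha, smul_assoc]
  let f : (free k E I).evalObj F →ₗ[RelAlgebra k F] (I →₀ RelAlgebra k F) :=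
    { toFun := f₀
      map_add' := f₀.map_add
      map_smul' := hlin }
  let g : (I →₀ RelAlgebra k F) →ₗ[RelAlgebra k F] (free k E I).evalObj F :=
    Finsupp.linearCombination (RelAlgebra k F) fun i =>
      (show (free k E I).evalObj F from freeSingle E I s i)
  have hgf : g ∘ₗ f = LinearMap.id := by
    ext x
    have hx : x ∈ Submodule.span k {x : (free k E I).obj F | ∃ R i, freeSingle E I R i = x} := by
      rw [span_freeSingle]
      trivial
    induction hx using Submodule.span_induction with
    | mem x hx =>
      obtain ⟨R, i, rfl⟩ := hx
      change g (f₀ _) = _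
      rw [hf₀]
      refine (Finsupp.linearCombination_single _ _ _).trans ?_
      refine (of_smul_evalObj _ F (r ≫ R) (freeSingle E I s i)).trans ?_
      rw [free_map_single, ← Category.assoc, hsr, Category.id_comp]
      rfl
    | zero => exact map_zero _
    | add x y _ _ hx hy =>
      exact ((g ∘ₗ f).map_add x y).trans (congrArg₂ (· + ·) hx hy)
    | smul c x _ hx =>
      have hc := algebraMap_smul_evalObj' (free k E I) F c x
      exact (congrArg (g ∘ₗ f) hc.symm).trans
        (((g ∘ₗ f).map_smul _ _).trans ((congrArg _ hx).trans hc))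
  have : Module.Projective (RelAlgebra k F) ((free k E I).evalObj F) :=
    Module.Projective.of_split f g hgf
  exact (IsProjective.iff_projective ((free k E I).evalObj F)).1 this

end

end CorrFunctor

/-! ### Dimension shifting for `Ext`. -/

section

universe w w' u₁ v₁ u₂ v₂

variable {C : Type u₁} [Category.{v₁} C] [Abelian C] {D : Type u₂} [Category.{v₂} D] [Abelian D]

/-- Dimension shifting for the map induced by an exact functor on `Ext`. -/
lemma CategoryTheory.Abelian.Ext.mapExactFunctor_bijective_succ [HasExt.{w} C] [HasExt.{w'} D]
    (G : C ⥤ D) [G.Additive] [PreservesFiniteLimits G] [PreservesFiniteColimits G]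
    {S : ShortComplex C} (hS : S.ShortExact) (Y : C) (i : ℕ)
    [Projective S.X₂] [Projective (G.obj S.X₂)]
    (h₁ : Function.Bijective
      (Ext.mapExactFunctor G : Ext.{w} S.X₁ Y i → Ext.{w'} (G.obj S.X₁) (G.obj Y) i))
    (h₂ : Function.Surjective
      (Ext.mapExactFunctor G : Ext.{w} S.X₂ Y i → Ext.{w'} (G.obj S.X₂) (G.obj Y) i)) :
    Function.Bijective (Ext.mapExactFunctor G :
      Ext.{w} S.X₃ Y (i + 1) → Ext.{w'} (G.obj S.X₃) (G.obj Y) (i + 1)) := by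
  have hGS := hS.map_of_exact G
  constructor
  · refine (injective_iff_map_eq_zero (G.mapExtAddHom S.X₃ Y (i + 1))).2 fun x hx => ?_
    rw [Functor.mapExtAddHom_apply] at hx
    obtain ⟨x₁, rfl⟩ := Ext.contravariant_sequence_exact₃ hS Y x
      (Ext.eq_zero_of_projective _) (add_comm 1 i)
    rw [Ext.mapExactFunctor_comp, Ext.mapExactFunctor_extClass] at hx
    obtain ⟨y₂, hy₂⟩ := Ext.contravariant_sequence_exact₁ hGS (G.obj Y)
      (x₁.mapExactFunctor G) (add_comm 1 i) hx
    -- `y₂` need not vanish when `i = 0`; lifting it treats all degrees uniformly.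
    obtain ⟨x₂, rfl⟩ := h₂ y₂
    have : (Ext.mk₀ S.f).comp x₂ (zero_add i) = x₁ := by
      apply h₁.1
      rw [Ext.mapExactFunctor_comp, Ext.mapExactFunctor_mk₀]
      exact hy₂
    rw [← this]
    exact hS.extClass_comp_assoc x₂
  · intro y
    obtain ⟨y₁, rfl⟩ := Ext.contravariant_sequence_exact₃ hGS (G.obj Y) y
      (Ext.eq_zero_of_projective (P := G.obj S.X₂) _) (add_comm 1 i)
    obtain ⟨x₁, rfl⟩ := h₁.2 y₁
    exact ⟨hS.extClass.comp x₁ (add_comm 1 i), by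
      rw [Ext.mapExactFunctor_comp, Ext.mapExactFunctor_extClass]
      rfl⟩

end

lemma CorrFunctor.exists_mapExactFunctor_bijective {k : Type u} [CommRing k]
    (N : CorrFunctor.{v} k) (i : ℕ) (M : CorrFunctor.{v} k) (hM : M.BoundedType) :
    ∃ n : ℕ, ∀ F : FinCorr.{v}, n ≤ F.card →
      Function.Bijective (Abelian.Ext.mapExactFunctor (evaluation k F) :
        Abelian.Ext.{max (u + 1) (v + 1)} M N i →
          Abelian.Ext.{max u v} ((evaluation k F).obj M) ((evaluation k F).obj N) i) := by
  induction i generalizing M with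
  | zero =>
    obtain ⟨E, hE⟩ := hM
    refine ⟨2 ^ E.card, fun F hF => ?_⟩
    rw [Abelian.Ext.mapExactFunctor₀]
    exact (Equiv.bijective _).comp ((evaluation_map_bijective hE hF).comp (Equiv.bijective _))
  | succ i ih =>
    obtain ⟨E, hE⟩ := hM
    let π := freeDesc M (id : M.obj E → M.obj E)
    have : Epi π := freeDesc_epi hE
    let S : ShortComplex (CorrFunctor.{v} k) := ShortComplex.mk (kernel.ι π) π (by simp)
    have hS : S.ShortExact :=
      { exact := ShortComplex.exact_of_f_is_kernel _ (kernelIsKernel π)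
        mono_f := inferInstanceAs (Mono (kernel.ι π))
        epi_g := this }
    have hP := free_generatedBy (k := k) E (M.obj E)
    have hK : (kernel π).BoundedType :=
      ⟨⟨ULift (Fin (2 ^ E.card))⟩, hP.of_mono (kernel.ι π) (by simp [FinCorr.card])⟩
    obtain ⟨n₁, h₁⟩ := ih _ hK
    obtain ⟨n₂, h₂⟩ := ih _ ⟨E, hP⟩
    -- Thresholds for the kernel and for the free cover in degree `i`, and for projectivity of the
    -- evaluated cover.
    refine ⟨max (max n₁ n₂) E.card, fun F hF => ?_⟩
    simp only [max_le_iff] at hF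
    have : Projective S.X₂ := free_projective E (M.obj E)
    have : Projective ((evaluation k F).obj S.X₂) := projective_evaluation_free _ hF.2
    exact Abelian.Ext.mapExactFunctor_bijective_succ (evaluation k F) hS N i (h₁ F hF.1.1)
      (h₂ F hF.1.2).2

theorem mainTheorem10 {k : Type u} [CommRing k] [IsNoetherianRing k] (M N : CorrFunctor.{v} k) :
    (∀ E F : FinCorr.{v}, M.GeneratedBy E → 2 ^ E.card ≤ F.card →
      Function.Bijective
        ((CorrFunctor.evaluation k F).mapLinearMap k :
          (M ⟶ N) →ₗ[k] ((CorrFunctor.evaluation k F).obj M ⟶ (CorrFunctor.evaluation k F).obj N)))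
    ∧ (M.BoundedType → ∀ i : ℕ, ∃ n : ℕ, ∀ F : FinCorr.{v}, n ≤ F.card →
      Function.Bijective
        ((CorrFunctor.evaluation k F).mapExtLinearMap k M N i :
          Abelian.Ext.{max (u + 1) (v + 1)} M N i →ₗ[k]
            Abelian.Ext.{max u v} ((CorrFunctor.evaluation k F).obj M)
              ((CorrFunctor.evaluation k F).obj N) i)) := by
  exact ⟨fun E F hM h => CorrFunctor.evaluation_map_bijective hM h, fun hM i =>
    CorrFunctor.exists_mapExactFunctor_bijective N i M hM⟩
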